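/- Let $P_{\theta}$, $\theta\in\mathcal T\subset\mathbb R^{d}$, be distributions on $\mathbb R^{p}$ possessing densities $f(y\mid\theta)$ with respect to a common dominating measure, let $\theta_0$ be an interior point of $\mathcal T$, and let $y_1,y_2,\dots$ be i.i.d. from $P_{\theta_0}$. Let $\zeta$ be a $d_\zeta$-dimensional sub-vector of $\theta$, with true value $\zeta_0$ (the corresponding sub-vector of $\theta_0$), and let $\mathcal Z\subset\mathbb R^{d_\zeta}$ be the set of values that $\zeta$ takes as $\theta$ ranges over $\mathcal T$. Let $f_1(y\mid\zeta)\ge 0$ be a pseudo-density (it need not integrate to one); put $\ell_1(\zeta,y)=\log f_1(y\mid\zeta)$ and $Q_n(\zeta)=\sum_{i=1}^n\ell_1(\zeta,y_i)$. Write $\mathcal B(\zeta_0,\delta)$ for the ball of radius $\delta$ about $\zeta_0$ and $\mathbb E_{\theta_0}$ for the expectation under $P_{\theta_0}$. Assume: 1. the set $\{y: f_1(y\mid\zeta)>0\}$ is the same for all $\zeta\in\mathcal Z$; 2. for some $\delta>0$, for $P_{\theta_0}$-almost every $y$, $\ell_1(\cdot,y)$ is finite and thrice differentiable on $\mathcal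 B(\zeta_0,\delta)\subset\mathcal Z$; for $\zeta$ in this ball, $\mathbb E_{\theta_0}\nabla_\zeta\ell_1(\zeta,y)$ and $\mathbb E_{\theta_0}\nabla^2_\zeta\ell_1(\zeta,y)$ are finite; and for every multi-index $\alpha$ with $|\alpha|=3$ there is $M_\alpha$ with $\sup_{\zeta\in\mathcal B(\zeta_0,\delta)}|\partial^\alpha\ell_1(\zeta,y)|\le M_\alpha(y)$ for $P_{\theta_0}$-almost every $y$ and $\mathbb E_{\theta_0}M_\alpha(y)<\infty$; 3. $\mathbb E_{\theta_0}\nabla_\zeta\ell_1(\zeta_0,y)=0$, $\ \mathbb E_{\theta_0}\nabla^2_\zeta\ell_1(\zeta_0,y)=-\mathbb E_{\theta_0}\big[\nabla_\zeta\ell_1(\zeta_0,y)\,\nabla_\zeta\ell_1(\zeta_0,y)^{\top}\big]$, and the Fisher information $-\mathbb E_{\theta_0}\nabla^2_\zeta\ell_1(\zeta_0,y)$ is positive definite; 4. for every $\delta>0$ there is $\epsilon>0$ such that, almost surely, $\sup_{\zeta\in\mathcal Z\setminus\mathcal B(\zeta_0,\delta)}\frac1n\big[Q_n(\zeta)-Q_n(\zeta_0)\big]<-\epsilon$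 for all sufficiently large $n$; 5. $\tilde\zeta_n$ is a maximizer of $Q_n$ over $\mathcal Z$ (almost surely, for all sufficiently large $n$), and $\tilde\zeta_n\to\zeta_0$ almost surely. Let $\pi$ be a prior probability density on $\mathcal Z$ that is continuous and positive at $\zeta_0$ and has finite expectation, $\int_{\mathcal Z}\|\zeta\|\pi(\zeta)\,d\zeta<\infty$. Let $\kappa_n(\zeta)\propto\exp\{Q_n(\zeta)\}\pi(\zeta)$ be the posterior density on $\mathcal Z$ and $\zeta^*_n=\int_{\mathcal Z}\zeta\,\kappa_n(\zeta)\,d\zeta$ the posterior mean. Then, almost surely, for all sufficiently large $n$ the posterior $\kappa_n$ is a well-defined probability density with finite expectation, and $$\lim_{n\to\infty}\sqrt n\,\big(\zeta^*_n-\tilde\zeta_n\big)=0 .$$ -/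

import Mathlib

open MeasureTheory ProbabilityTheory Filter Topology

noncomputable section

/-- A dominated statistical model for `p`-dimensional observations, with a `d`-dimensional
parameter: a parameter set and, for each parameter in it, a probability density with respect to
a common dominating measure (Lebesgue measure for continuous data, counting measure for discrete
data, and so on). -/
structure DominatedModel (p d : ℕ) where
  /-- the parameter set -/
  paramSet : Set (EuclideanSpace ℝ (Fin d))
  /-- the dominating measure -/
  dom : Measure (EuclideanSpace ℝ (Fin p))
  /-- the density at the parameter `θ` -/
  density : EuclideanSpace ℝ (Fin d) → EuclideanSpace ℝ (Fin p) → ℝ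
  density_measurable : ∀ θ ∈ paramSet, Measurable (density θ)
  density_nonneg : ∀ θ ∈ paramSet, ∀ y, 0 ≤ density θ y
  density_lintegral : ∀ θ ∈ paramSet, ∫⁻ y, ENNReal.ofReal (density θ y) ∂dom = 1

/-- The distribution `P_θ` of one observation. -/
def DominatedModel.law {p d : ℕ} (M : DominatedModel p d) (θ : EuclideanSpace ℝ (Fin d)) :
    Measure (EuclideanSpace ℝ (Fin p)) :=
  M.dom.withDensity fun y => ENNReal.ofReal (M.density θ y)

/-- The sub-vector of `θ` with the coordinates selected by `sel`. -/
def subvector {d k : ℕ} (sel : Fin k ↪ Fin d) (θ : EuclideanSpace ℝ (Fin d)) :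
    EuclideanSpace ℝ (Fin k) :=
  WithLp.toLp 2 fun i => θ (sel i)

/-- The `i`-th partial derivative of `g`. -/
def partialD {k : ℕ} (i : Fin k) (g : EuclideanSpace ℝ (Fin k) → ℝ)
    (z : EuclideanSpace ℝ (Fin k)) : ℝ :=
  fderiv ℝ g z (EuclideanSpace.single i 1)

/-- `g` is thrice (Fréchet) differentiable on the open set `U`: `g` and all its partial
derivatives of orders one and two are differentiable there. -/
def ThriceDifferentiableOn {k : ℕ} (g : EuclideanSpace ℝ (Fin k) → ℝ)
    (U : Set (EuclideanSpace ℝ (Fin k))) : Prop :=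
  DifferentiableOn ℝ g U ∧ (∀ i, DifferentiableOn ℝ (partialD i g) U) ∧
    ∀ i j, DifferentiableOn ℝ (partialD i (partialD j g)) U

section Likelihood

variable {p k : ℕ}

/-- The log pseudo-density `ℓ₁(ζ, y) = log f₁(y|ζ)`, as a function of `ζ`. -/
def logLik (f₁ : EuclideanSpace ℝ (Fin p) → EuclideanSpace ℝ (Fin k) → ℝ)
    (y : EuclideanSpace ℝ (Fin p)) (ζ : EuclideanSpace ℝ (Fin k)) : ℝ :=
  Real.log (f₁ y ζ)

/-- The composite log-likelihood `Q_n(ζ)` of the first `n` terms of the data sequence `y`. -/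
def compLogLik (f₁ : EuclideanSpace ℝ (Fin p) → EuclideanSpace ℝ (Fin k) → ℝ)
    (y : ℕ → EuclideanSpace ℝ (Fin p)) (n : ℕ) (ζ : EuclideanSpace ℝ (Fin k)) : ℝ :=
  ∑ i ∈ Finset.range n, logLik f₁ (y i) ζ

/-- The posterior density `κ_n` on the parameter set `Z`, proportional to `exp(Q_n) π₀`. -/
def knotPosterior (f₁ : EuclideanSpace ℝ (Fin p) → EuclideanSpace ℝ (Fin k) → ℝ)
    (Z : Set (EuclideanSpace ℝ (Fin k))) (π₀ : EuclideanSpace ℝ (Fin k) → ℝ)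
    (y : ℕ → EuclideanSpace ℝ (Fin p)) (n : ℕ) (ζ : EuclideanSpace ℝ (Fin k)) : ℝ :=
  Real.exp (compLogLik f₁ y n ζ) * π₀ ζ / ∫ z in Z, Real.exp (compLogLik f₁ y n z) * π₀ z

/-- The posterior mean `ζ*_n`, the expectation of `κ_n`. -/
def knotPosteriorMean (f₁ : EuclideanSpace ℝ (Fin p) → EuclideanSpace ℝ (Fin k) → ℝ)
    (Z : Set (EuclideanSpace ℝ (Fin k))) (π₀ : EuclideanSpace ℝ (Fin k) → ℝ)
    (y : ℕ → EuclideanSpace ℝ (Fin p)) (n : ℕ) : EuclideanSpace ℝ (Fin k) :=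
  ∫ ζ in Z, knotPosterior f₁ Z π₀ y n ζ • ζ

/-- `f₁` is a pseudo-density with parameter set `Z`: nonnegative, measurable in the observation
and (Lebesgue) measurable in the parameter; it need not integrate to one. -/
structure IsPseudoDensity (f₁ : EuclideanSpace ℝ (Fin p) → EuclideanSpace ℝ (Fin k) → ℝ)
    (Z : Set (EuclideanSpace ℝ (Fin k))) : Prop where
  nonneg : ∀ y, ∀ ζ ∈ Z, 0 ≤ f₁ y ζ
  measurable_obs : ∀ ζ ∈ Z, Measurable fun y => f₁ y ζ
  measurable_param : ∀ y, AEMeasurable (f₁ y) (volume.restrict Z)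

/-- The support of `f₁(·|ζ)` does not depend on `ζ`. -/
def CommonSupport (f₁ : EuclideanSpace ℝ (Fin p) → EuclideanSpace ℝ (Fin k) → ℝ)
    (Z : Set (EuclideanSpace ℝ (Fin k))) : Prop :=
  ∀ ζ ∈ Z, ∀ ζ' ∈ Z, {y | 0 < f₁ y ζ} = {y | 0 < f₁ y ζ'}

/-- Near `ζ₀` the log pseudo-density is (almost surely) a real number and thrice differentiable
in the parameter, its first two derivatives have finite expectations, and its third-order
partial derivatives are dominated, uniformly in the parameter, by integrable functions. -/
def SmoothLogLik (P : Measure (EuclideanSpace ℝ (Fin p)))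
    (f₁ : EuclideanSpace ℝ (Fin p) → EuclideanSpace ℝ (Fin k) → ℝ)
    (Z : Set (EuclideanSpace ℝ (Fin k))) (ζ₀ : EuclideanSpace ℝ (Fin k)) : Prop :=
  ∃ δ > 0, Metric.ball ζ₀ δ ⊆ Z ∧
    (∀ᵐ y ∂P, (∀ ζ ∈ Metric.ball ζ₀ δ, 0 < f₁ y ζ) ∧
      ThriceDifferentiableOn (logLik f₁ y) (Metric.ball ζ₀ δ)) ∧
    (∀ ζ ∈ Metric.ball ζ₀ δ,
      (∀ i, Integrable (fun y => partialD i (logLik f₁ y) ζ) P) ∧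
      (∀ i j, Integrable (fun y => partialD i (partialD j (logLik f₁ y)) ζ) P)) ∧
    ∃ M : Fin k → Fin k → Fin k → EuclideanSpace ℝ (Fin p) → ℝ,
      (∀ i j l, Integrable (M i j l) P) ∧
      ∀ i j l, ∀ᵐ y ∂P, ∀ ζ ∈ Metric.ball ζ₀ δ,
        |partialD i (partialD j (partialD l (logLik f₁ y))) ζ| ≤ M i j l y

/-- The Fisher information matrix `-E ∇² ℓ₁(ζ₀, y)`. -/
def fisherInfo (P : Measure (EuclideanSpace ℝ (Fin p)))
    (f₁ : EuclideanSpace ℝ (Fin p) → EuclideanSpace ℝ (Fin k) → ℝ)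
    (ζ₀ : EuclideanSpace ℝ (Fin k)) : Matrix (Fin k) (Fin k) ℝ :=
  Matrix.of fun i j => -∫ y, partialD i (partialD j (logLik f₁ y)) ζ₀ ∂P

/-- The score has mean zero at `ζ₀`, its second moment matrix there is the Fisher information
matrix, and that matrix is positive definite. -/
structure FisherRegular (P : Measure (EuclideanSpace ℝ (Fin p)))
    (f₁ : EuclideanSpace ℝ (Fin p) → EuclideanSpace ℝ (Fin k) → ℝ)
    (ζ₀ : EuclideanSpace ℝ (Fin k)) : Prop where
  score_mean : ∀ i, ∫ y, partialD i (logLik f₁ y) ζ₀ ∂P = 0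
  score_sq_integrable : ∀ i j,
    Integrable (fun y => partialD i (logLik f₁ y) ζ₀ * partialD j (logLik f₁ y) ζ₀) P
  information_eq : ∀ i j, ∫ y, partialD i (partialD j (logLik f₁ y)) ζ₀ ∂P =
    -∫ y, partialD i (logLik f₁ y) ζ₀ * partialD j (logLik f₁ y) ζ₀ ∂P
  posDef : (fisherInfo P f₁ ζ₀).PosDef

variable {Ω : Type*} [MeasurableSpace Ω]

/-- For each `δ > 0` there is `ε > 0` such that almost surely, for all large `n`,
`(Q_n(ζ) - Q_n(ζ₀)) / n < -ε` for all parameters outside the ball `B(ζ₀, δ)`.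
(As `ε` may be halved, this is the bound on the supremum.) -/
def WellSeparated (μ : Measure Ω) (Y : ℕ → Ω → EuclideanSpace ℝ (Fin p))
    (f₁ : EuclideanSpace ℝ (Fin p) → EuclideanSpace ℝ (Fin k) → ℝ)
    (Z : Set (EuclideanSpace ℝ (Fin k))) (ζ₀ : EuclideanSpace ℝ (Fin k)) : Prop :=
  ∀ δ > 0, ∃ ε > 0, ∀ᵐ ω ∂μ, ∀ᶠ n : ℕ in atTop, ∀ ζ ∈ Z \ Metric.ball ζ₀ δ,
    (1 / (n : ℝ)) *
      (compLogLik f₁ (fun i => Y i ω) n ζ - compLogLik f₁ (fun i => Y i ω) n ζ₀) < -ε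

/-- `ζt n` maximizes `Q_n` over `Z` (almost surely, for all large `n`), and it is strongly
consistent at `ζ₀`. -/
structure ConsistentMaximizer (μ : Measure Ω) (Y : ℕ → Ω → EuclideanSpace ℝ (Fin p))
    (f₁ : EuclideanSpace ℝ (Fin p) → EuclideanSpace ℝ (Fin k) → ℝ)
    (Z : Set (EuclideanSpace ℝ (Fin k))) (ζ₀ : EuclideanSpace ℝ (Fin k))
    (ζt : ℕ → Ω → EuclideanSpace ℝ (Fin k)) : Prop where
  isMax : ∀ᵐ ω ∂μ, ∀ᶠ n in atTop,
    ζt n ω ∈ Z ∧ IsMaxOn (compLogLik f₁ (fun i => Y i ω) n) Z (ζt n ω)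
  consistent : ∀ᵐ ω ∂μ, Tendsto (fun n => ζt n ω) atTop (𝓝 ζ₀)

end Likelihood

/-- `π₀` is a prior (probability) density on `Z` that is continuous and positive at `ζ₀`. -/
structure IsPriorDensity {k : ℕ} (π₀ : EuclideanSpace ℝ (Fin k) → ℝ)
    (Z : Set (EuclideanSpace ℝ (Fin k))) (ζ₀ : EuclideanSpace ℝ (Fin k)) : Prop where
  nonneg : ∀ ζ ∈ Z, 0 ≤ π₀ ζ
  integrableOn : IntegrableOn π₀ Z
  integral_eq_one : ∫ ζ in Z, π₀ ζ = 1
  continuousAt : ContinuousAt π₀ ζ₀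
  pos : 0 < π₀ ζ₀

end

/-! This is Laplace's method at the maximizer `z n` of `Q n`. In the variable `u = √n (ζ - z n)`,
the weight `exp (Q n ζ - Q n (z n)) * π ζ` tends to `exp (-q u / 2) * π ζ₀`, where `q` is the
quadratic form of the Fisher information. Then `√n` times (posterior mean minus `z n`) is the ratio
of the integrals of `u` and of `1` against the rescaled weight. The numerator tends to the first
moment of an even Gaussian, which is zero, and the denominator to a positive number.

The expansion of `Q n` (`quadratic_expansion_near_argmax`) has no linear term, because the maximizer
is eventually interior. Its Hessian is controlled by `tendsto_average_prod_nhds`: the strong law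
gives convergence at `ζ₀`, and the third-derivative bounds, averaged by the strong law again, make
the averaged Hessians uniformly Lipschitz. The error is `n * η * ‖ζ - z n‖ ^ 2` on a ball depending
on `η`. Arbitrarily small `η` yields the pointwise limit of the weight; one fixed `η`, small against
the least value of `q` on the unit sphere, yields a Gaussian majorant. Dominated convergence then
handles a ball (`tendsto_ball_weight`). Off the ball, separation gives a factor `exp (-(n * ε))`,
and the finite prior mean bounds what remains (`tendsto_tail_weight`).

Probability enters only through countably many almost sure statements; the rest is deterministic,
for a fixed data sequence. -/

/-! ### Averaged Hessians and the quadratic expansion at the maximizer -/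

theorem fderiv_apply_eq_sum_partialD {k : ℕ} (g : EuclideanSpace ℝ (Fin k) → ℝ)
    (z v : EuclideanSpace ℝ (Fin k)) :
    fderiv ℝ g z v = ∑ i, v i * partialD i g z := by
  have hv : v = ∑ i, v i • EuclideanSpace.single i (1 : ℝ) := by
    simpa using ((EuclideanSpace.basisFun (Fin k) ℝ).sum_repr v).symm
  conv_lhs => rw [hv]
  simp [partialD]

theorem norm_fderiv_le_of_partialD_le {k : ℕ} {g : EuclideanSpace ℝ (Fin k) → ℝ}
    {z : EuclideanSpace ℝ (Fin k)} {M : Fin k → ℝ} (hM : ∀ i, |partialD i g z| ≤ M i) :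
    ‖fderiv ℝ g z‖ ≤ ∑ i, M i := by
  have hM0 : ∀ i, 0 ≤ M i := fun i => (abs_nonneg _).trans (hM i)
  refine ContinuousLinearMap.opNorm_le_bound _ (Finset.sum_nonneg fun i _ => hM0 i) fun v => ?_
  rw [fderiv_apply_eq_sum_partialD, Finset.sum_mul]
  refine (norm_sum_le _ _).trans (Finset.sum_le_sum fun i _ => ?_)
  rw [norm_mul, mul_comm]
  exact mul_le_mul (hM i) (PiLp.norm_apply_le v i) (norm_nonneg _) (hM0 i)

theorem abs_sub_le_of_partialD_le {k : ℕ} {g : EuclideanSpace ℝ (Fin k) → ℝ}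
    {ζ₀ ζ : EuclideanSpace ℝ (Fin k)} {δ : ℝ} {M : Fin k → ℝ}
    (hg : DifferentiableOn ℝ g (Metric.ball ζ₀ δ))
    (hM : ∀ i, ∀ x ∈ Metric.ball ζ₀ δ, |partialD i g x| ≤ M i) (hζ : ζ ∈ Metric.ball ζ₀ δ) :
    |g ζ - g ζ₀| ≤ (∑ i, M i) * ‖ζ - ζ₀‖ :=
  Convex.norm_image_sub_le_of_norm_fderiv_le (𝕜 := ℝ)
    (fun _ hx => hg.differentiableAt (Metric.isOpen_ball.mem_nhds hx))
    (fun x hx => norm_fderiv_le_of_partialD_le fun i => hM i x hx) (convex_ball ζ₀ δ)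
    (Metric.mem_ball_self (Metric.pos_of_mem_ball hζ)) hζ

/-- Averages of functions with Lipschitz constants bounded on average converge locally
uniformly near a point as soon as they converge at this point. -/
theorem tendsto_average_prod_nhds {k : ℕ} {g : ℕ → EuclideanSpace ℝ (Fin k) → ℝ}
    {ζ₀ : EuclideanSpace ℝ (Fin k)} {δ a : ℝ} {M : Fin k → ℕ → ℝ} {b : Fin k → ℝ} (hδ : 0 < δ)
    (hg : ∀ m, DifferentiableOn ℝ (g m) (Metric.ball ζ₀ δ))
    (hM : ∀ m i, ∀ x ∈ Metric.ball ζ₀ δ, |partialD i (g m) x| ≤ M i m)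
    (ha : Tendsto (fun n : ℕ => (∑ m ∈ Finset.range n, g m ζ₀) / n) atTop (𝓝 a))
    (hb : ∀ i, Tendsto (fun n : ℕ => (∑ m ∈ Finset.range n, M i m) / n) atTop (𝓝 (b i))) :
    Tendsto (fun p : ℕ × EuclideanSpace ℝ (Fin k) =>
      (∑ m ∈ Finset.range p.1, g m p.2) / p.1) (atTop ×ˢ 𝓝 ζ₀) (𝓝 a) := by
  -- The averaged Lipschitz constants converge, hence stay bounded, while the distance to `ζ₀`
  -- vanishes.
  have h0 : Tendsto (fun p : ℕ × EuclideanSpace ℝ (Fin k) =>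
      (∑ i, (∑ m ∈ Finset.range p.1, M i m) / p.1) * ‖p.2 - ζ₀‖) (atTop ×ˢ 𝓝 ζ₀) (𝓝 0) := by
    have h1 : Tendsto (fun p : ℕ × EuclideanSpace ℝ (Fin k) =>
        ∑ i, (∑ m ∈ Finset.range p.1, M i m) / p.1) (atTop ×ˢ 𝓝 ζ₀) (𝓝 (∑ i, b i)) :=
      tendsto_finsetSum _ fun i _ => (hb i).comp tendsto_fst
    have h2 : Tendsto (fun p : ℕ × EuclideanSpace ℝ (Fin k) => ‖p.2 - ζ₀‖)
        (atTop ×ˢ 𝓝 ζ₀) (𝓝 0) := by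
      have : Tendsto (fun x : EuclideanSpace ℝ (Fin k) => ‖x - ζ₀‖) (𝓝 ζ₀) (𝓝 ‖ζ₀ - ζ₀‖) :=
        ((continuous_id.sub continuous_const).norm).tendsto ζ₀
      rw [sub_self, norm_zero] at this
      exact this.comp tendsto_snd
    simpa using h1.mul h2
  have h3 : Tendsto (fun p : ℕ × EuclideanSpace ℝ (Fin k) =>
      (∑ m ∈ Finset.range p.1, g m p.2) / p.1 - (∑ m ∈ Finset.range p.1, g m ζ₀) / p.1)
      (atTop ×ˢ 𝓝 ζ₀) (𝓝 0) := by
    refine squeeze_zero_norm' ?_ h0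
    filter_upwards [tendsto_snd.eventually (Metric.ball_mem_nhds ζ₀ hδ)] with p hp
    rw [← sub_div, ← Finset.sum_sub_distrib, norm_div, Real.norm_natCast, ← Finset.sum_div,
      div_mul_eq_mul_div]
    refine div_le_div_of_nonneg_right ?_ (Nat.cast_nonneg _)
    rw [Finset.sum_comm, Finset.sum_mul]
    exact (norm_sum_le _ _).trans
      (Finset.sum_le_sum fun m _ => abs_sub_le_of_partialD_le (hg m) (hM m) hp)
  simpa using h3.add (ha.comp tendsto_fst)

/-- The mean value inequality is applied twice, to `φ' t + b * t` and then to `φ t + b / 2 * t ^ 2`.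
This needs no continuity of `φ''`; the lost factor `1 / 2` is harmless. -/
theorem abs_sub_add_half_le_of_second_deriv {φ φ' φ'' : ℝ → ℝ} {b B : ℝ}
    (h1 : ∀ t ∈ Set.Icc (0 : ℝ) 1, HasDerivAt φ (φ' t) t)
    (h2 : ∀ t ∈ Set.Icc (0 : ℝ) 1, HasDerivAt φ' (φ'' t) t) (h0 : φ' 0 = 0)
    (hB : ∀ t ∈ Set.Icc (0 : ℝ) 1, |φ'' t + b| ≤ B) :
    |φ 1 - φ 0 + b / 2| ≤ B := by
  have hB0 : 0 ≤ B := (abs_nonneg _).trans (hB 0 (by simp))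
  have d1 : ∀ t ∈ Set.Icc (0 : ℝ) 1, |φ' t + b * t| ≤ B := by
    intro t ht
    have := norm_image_sub_le_of_norm_deriv_le_segment' (f := fun t => φ' t + b * t)
      (f' := fun t => φ'' t + b) (C := B) (a := 0) (b := 1)
      (fun x hx => by
        simpa using ((h2 x hx).fun_add ((hasDerivAt_id x).const_mul b)).hasDerivWithinAt)
      (fun x hx => hB x (Set.Ico_subset_Icc_self hx)) t ht
    simp only [h0, mul_zero, add_zero, sub_zero, Real.norm_eq_abs] at this
    exact this.trans (mul_le_of_le_one_right hB0 ht.2)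
  have := norm_image_sub_le_of_norm_deriv_le_segment_01' (f := fun t => φ t + b / 2 * t ^ 2)
    (f' := fun t => φ' t + b * t) (C := B)
    (fun x hx => by
      have := ((h1 x hx).fun_add ((hasDerivAt_pow 2 x).const_mul (b / 2))).hasDerivWithinAt
        (s := Set.Icc (0 : ℝ) 1)
      convert this using 1
      norm_num
      ring)
    (fun x hx => d1 x (Set.Ico_subset_Icc_self hx))
  simp only [Real.norm_eq_abs] at this
  convert this using 2
  ring

theorem hasDerivAt_comp_segment {k : ℕ} {g : EuclideanSpace ℝ (Fin k) → ℝ}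
    {z v : EuclideanSpace ℝ (Fin k)} {t : ℝ} (hg : DifferentiableAt ℝ g (z + t • v)) :
    HasDerivAt (fun s : ℝ => g (z + s • v)) (∑ i, v i * partialD i g (z + t • v)) t := by
  rw [← fderiv_apply_eq_sum_partialD]
  have h : HasDerivAt (fun s : ℝ => z + s • v) v t := by
    simpa using ((hasDerivAt_id t).smul_const v).const_add z
  exact hg.hasFDerivAt.comp_hasDerivAt t h

/-- Second-order expansion of a sum of functions around its maximizer, in terms of the limit
of the averaged Hessians. -/
theorem quadratic_expansion_near_argmax {k : ℕ} {g : ℕ → EuclideanSpace ℝ (Fin k) → ℝ}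
    {ζ₀ : EuclideanSpace ℝ (Fin k)} {δ : ℝ} (hδ : 0 < δ) {A : Fin k → Fin k → ℝ}
    (hg : ∀ m, ThriceDifferentiableOn (g m) (Metric.ball ζ₀ δ))
    (hA : ∀ i j, Tendsto (fun p : ℕ × EuclideanSpace ℝ (Fin k) =>
      (∑ m ∈ Finset.range p.1, partialD i (partialD j (g m)) p.2) / p.1)
      (atTop ×ˢ 𝓝 ζ₀) (𝓝 (-A i j)))
    {z : ℕ → EuclideanSpace ℝ (Fin k)} (hz : Tendsto z atTop (𝓝 ζ₀))
    (hmax : ∀ᶠ n in atTop, IsLocalMax (fun ζ => ∑ m ∈ Finset.range n, g m ζ) (z n))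
    {η : ℝ} (hη : 0 < η) :
    ∃ r > 0, ∀ᶠ n : ℕ in atTop, ∀ ζ ∈ Metric.ball ζ₀ r,
      |∑ m ∈ Finset.range n, g m ζ - ∑ m ∈ Finset.range n, g m (z n) +
        n / 2 * ∑ j, ∑ i, (ζ - z n) j * (ζ - z n) i * A i j| ≤ n * η * ‖ζ - z n‖ ^ 2 := by
  -- Each of the `k ^ 2` Hessian entries may err by `η'`; the `+ 1` covers `k = 0`.
  set η' : ℝ := η / (k ^ 2 + 1)
  have hη' : 0 < η' := by positivity
  have hkη : (k : ℝ) ^ 2 * η' ≤ η := by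
    rw [← mul_div_assoc, div_le_iff₀ (by positivity)]
    nlinarith
  have hev : ∀ᶠ p : ℕ × EuclideanSpace ℝ (Fin k) in atTop ×ˢ 𝓝 ζ₀, ∀ i j,
      |(∑ m ∈ Finset.range p.1, partialD i (partialD j (g m)) p.2) / p.1 + A i j| ≤ η' := by
    refine eventually_all.2 fun i => eventually_all.2 fun j => ?_
    filter_upwards [(hA i j).eventually (Metric.closedBall_mem_nhds _ hη')] with p hp
    simpa [Real.dist_eq] using hp
  obtain ⟨pa, hpa, pb, hpb, hab⟩ := eventually_prod_iff.1 hev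
  obtain ⟨r₀, hr₀, hr₀b⟩ := Metric.eventually_nhds_iff_ball.1 hpb
  refine ⟨min r₀ δ, lt_min hr₀ hδ, ?_⟩
  filter_upwards [hpa, hmax, eventually_gt_atTop 0,
    hz.eventually (Metric.ball_mem_nhds ζ₀ (lt_min hr₀ hδ))] with n hn hmaxn hn0 hzn ζ hζ
  have hn0' : (0 : ℝ) < n := Nat.cast_pos.2 hn0
  set v := ζ - z n with hv
  have hmem : ∀ t ∈ Set.Icc (0 : ℝ) 1, z n + t • v ∈ Metric.ball ζ₀ (min r₀ δ) := fun t ht =>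
    (convex_ball ζ₀ (min r₀ δ)).add_smul_sub_mem hzn hζ ht
  have hmemδ : ∀ t ∈ Set.Icc (0 : ℝ) 1, Metric.ball ζ₀ δ ∈ 𝓝 (z n + t • v) := fun t ht =>
    Metric.isOpen_ball.mem_nhds (Metric.ball_subset_ball (min_le_right _ _) (hmem t ht))
  -- The sum is restricted to the segment from `z n` to `ζ`, which stays in the ball by convexity.
  set φ : ℝ → ℝ := fun t => ∑ m ∈ Finset.range n, g m (z n + t • v)
  set φ' : ℝ → ℝ := fun t => ∑ m ∈ Finset.range n, ∑ j, v j * partialD j (g m) (z n + t • v)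
  set φ'' : ℝ → ℝ := fun t => ∑ m ∈ Finset.range n, ∑ j, v j *
    ∑ i, v i * partialD i (partialD j (g m)) (z n + t • v)
  have h1 : ∀ t ∈ Set.Icc (0 : ℝ) 1, HasDerivAt φ (φ' t) t := fun t ht =>
    HasDerivAt.fun_sum fun m _ => hasDerivAt_comp_segment ((hg m).1.differentiableAt (hmemδ t ht))
  have h2 : ∀ t ∈ Set.Icc (0 : ℝ) 1, HasDerivAt φ' (φ'' t) t := fun t ht =>
    HasDerivAt.fun_sum fun m _ => HasDerivAt.fun_sum fun j _ =>
      (hasDerivAt_comp_segment (((hg m).2.1 j).differentiableAt (hmemδ t ht))).const_mul (v j)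
  have h0 : φ' 0 = 0 := by
    refine IsLocalMax.hasDerivAt_eq_zero ?_ (h1 0 (by simp))
    have hc : ContinuousAt (fun t : ℝ => z n + t • v) 0 := by fun_prop
    have hl : IsLocalMax (fun ζ => ∑ m ∈ Finset.range n, g m ζ) (z n + (0 : ℝ) • v) := by
      simpa using hmaxn
    exact hc.eventually hl
  have hB : ∀ t ∈ Set.Icc (0 : ℝ) 1,
      |φ'' t + n * ∑ j, ∑ i, v j * v i * A i j| ≤ n * η * ‖v‖ ^ 2 := by
    intro t ht
    have hij := hab hn (hr₀b _ (Metric.ball_subset_ball (min_le_left _ _) (hmem t ht)))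
    have heq : φ'' t + n * ∑ j, ∑ i, v j * v i * A i j = n * ∑ j, ∑ i, v j * v i *
        ((∑ m ∈ Finset.range n, partialD i (partialD j (g m)) (z n + t • v)) / n + A i j) := by
      simp only [mul_add, Finset.sum_add_distrib, add_left_inj, φ'']
      rw [Finset.sum_comm, Finset.mul_sum]
      refine Finset.sum_congr rfl fun j _ => ?_
      simp only [Finset.mul_sum, Finset.sum_div]
      rw [Finset.sum_comm]
      refine Finset.sum_congr rfl fun i _ => Finset.sum_congr rfl fun m _ => ?_
      field_simp
    rw [heq, abs_mul, abs_of_pos hn0', mul_assoc]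
    refine mul_le_mul_of_nonneg_left ?_ hn0'.le
    calc |∑ j, ∑ i, v j * v i *
        ((∑ m ∈ Finset.range n, partialD i (partialD j (g m)) (z n + t • v)) / n + A i j)|
        ≤ ∑ _j : Fin k, ∑ _i : Fin k, ‖v‖ * ‖v‖ * η' := by
          refine (Finset.abs_sum_le_sum_abs _ _).trans (Finset.sum_le_sum fun j _ => ?_)
          refine (Finset.abs_sum_le_sum_abs _ _).trans (Finset.sum_le_sum fun i _ => ?_)
          rw [abs_mul, abs_mul]
          have := hij i j
          gcongr
          · exact PiLp.norm_apply_le v j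
          · exact PiLp.norm_apply_le v i
      _ = ((k : ℝ) ^ 2 * η') * ‖v‖ ^ 2 := by
          simp; ring
      _ ≤ η * ‖v‖ ^ 2 := by gcongr
  have := abs_sub_add_half_le_of_second_deriv h1 h2 h0 hB
  convert this using 2
  simp only [φ, v, one_smul, zero_smul, add_zero, add_sub_cancel]
  ring

/-! ### Gaussian majorant and bounds on the weight -/

/-- Half of the exponent absorbs the linear factor: `1 + ‖u‖ ≤ exp ‖u‖`, and completing the square
gives `‖u‖ ≤ a / 2 * ‖u‖ ^ 2 + 1 / (2 * a)`. -/
theorem integrable_exp_neg_mul_sq_norm_mul_one_add_norm {E : Type*} [NormedAddCommGroup E]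
    [InnerProductSpace ℝ E] [FiniteDimensional ℝ E] [MeasurableSpace E] [BorelSpace E]
    {a : ℝ} (ha : 0 < a) :
    Integrable fun u : E => Real.exp (-(a * ‖u‖ ^ 2)) * (1 + ‖u‖) := by
  have h : Integrable fun u : E => Real.exp (-(a / 2 * ‖u‖ ^ 2)) := by
    have := (GaussianFourier.integrable_cexp_neg_mul_sq_norm_add (V := E) (b := ((a / 2 : ℝ) : ℂ))
      (by simpa using ha) 0 0).norm
    refine this.congr (ae_of_all _ fun u => ?_)
    simp only [Complex.norm_exp]
    congr 1
    norm_cast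
    simp
  refine (h.const_mul (Real.exp (1 / (2 * a)))).mono'
    (Continuous.aestronglyMeasurable (by fun_prop)) (ae_of_all _ fun u => ?_)
  have h0 := norm_nonneg u
  rw [Real.norm_of_nonneg (by positivity), ← Real.exp_add]
  have h1 : 1 + ‖u‖ ≤ Real.exp ‖u‖ := by linarith [Real.add_one_le_exp ‖u‖]
  calc Real.exp (-(a * ‖u‖ ^ 2)) * (1 + ‖u‖) ≤ Real.exp (-(a * ‖u‖ ^ 2)) * Real.exp ‖u‖ := by
        gcongr
    _ ≤ _ := by
        rw [← Real.exp_add]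
        refine Real.exp_le_exp.2 ?_
        have : 1 / (2 * a) + -(a / 2 * ‖u‖ ^ 2) - (-(a * ‖u‖ ^ 2) + ‖u‖)
            = (a * ‖u‖ - 1) ^ 2 / (2 * a) := by
          field_simp
          ring
        have : 0 ≤ (a * ‖u‖ - 1) ^ 2 / (2 * a) := by positivity
        linarith

theorem norm_comp_smul_sub_le {E G : Type*} [NormedAddCommGroup E] [NormedSpace ℝ E]
    [NormedAddCommGroup G] {F : E → G} (hFb : ∀ u, ‖F u‖ ≤ 1 + ‖u‖) {s : ℝ}
    (hs : 0 ≤ s) (ζ z : E) : ‖F (s • (ζ - z))‖ ≤ (1 + s * ‖z‖) + s * ‖ζ‖ := by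
  refine (hFb _).trans ?_
  rw [norm_smul, Real.norm_of_nonneg hs]
  nlinarith [norm_sub_le ζ z]

theorem aestronglyMeasurable_comp_add_smul {E G : Type*} [NormedAddCommGroup E]
    [InnerProductSpace ℝ E] [FiniteDimensional ℝ E] [MeasurableSpace E] [BorelSpace E]
    [TopologicalSpace G] {f : E → G} (hf : AEStronglyMeasurable f volume)
    (z : E) {s : ℝ} (hs : s ≠ 0) : AEStronglyMeasurable (fun u => f (z + s • u)) volume := by
  have h1 : AEStronglyMeasurable (fun u => f (z + u)) volume :=
    hf.comp_measurePreserving (measurePreserving_add_left volume z)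
  exact h1.comp_quasiMeasurePreserving (Measure.quasiMeasurePreserving_smul volume hs)

/-- The growth condition on `F` covers both `F = 1` and `F = id`, the two cases needed. The bound is
affine in `‖ζ‖`, so a prior with finite first moment makes it integrable. -/
theorem norm_weight_le {E G : Type*} [NormedAddCommGroup E] [NormedSpace ℝ E]
    [NormedAddCommGroup G] [NormedSpace ℝ G] {Q π : E → ℝ} {F : E → G} (hFb : ∀ u, ‖F u‖ ≤ 1 + ‖u‖)
    {s : ℝ} (hs : 0 ≤ s) {ζ z : E} {b : ℝ} (hQ : Q ζ - Q z ≤ b) (hπ : 0 ≤ π ζ) :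
    ‖(Real.exp (Q ζ - Q z) * π ζ) • F (s • (ζ - z))‖ ≤
      Real.exp b * ((1 + s * ‖z‖) * π ζ + s * (π ζ * ‖ζ‖)) := by
  rw [norm_smul, Real.norm_of_nonneg (by positivity)]
  calc Real.exp (Q ζ - Q z) * π ζ * ‖F (s • (ζ - z))‖
      ≤ Real.exp b * π ζ * ((1 + s * ‖z‖) + s * ‖ζ‖) := by
        have := norm_comp_smul_sub_le hFb hs ζ z
        gcongr
    _ = _ := by ring

/-! ### Laplace approximation -/

section Laplace

variable {E G : Type*} [NormedAddCommGroup E] [InnerProductSpace ℝ E] [FiniteDimensional ℝ E]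
  [MeasurableSpace E] [BorelSpace E] [NormedAddCommGroup G] [NormedSpace ℝ G]

theorem aestronglyMeasurable_weight {S : Set E} {Q π : E → ℝ}
    (hQ : AEMeasurable Q (volume.restrict S)) (hπ : AEStronglyMeasurable π (volume.restrict S))
    {F : E → G} (hF : Continuous F) (s : ℝ) (z : E) :
    AEStronglyMeasurable (fun ζ => (Real.exp (Q ζ - Q z) * π ζ) • F (s • (ζ - z)))
      (volume.restrict S) := by
  have hc : Continuous fun ζ => F (s • (ζ - z)) := by fun_prop
  have he : AEMeasurable (fun ζ => Real.exp (Q ζ - Q z)) (volume.restrict S) :=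
    Real.measurable_exp.comp_aemeasurable (hQ.sub_const _)
  exact (he.aestronglyMeasurable.mul hπ).smul hc.aestronglyMeasurable

theorem integrableOn_weight {S : Set E} (hS : NullMeasurableSet S volume) {Q π : E → ℝ}
    (hQ : AEMeasurable Q (volume.restrict S)) (hπ : ∀ ζ ∈ S, 0 ≤ π ζ)
    (hπi : IntegrableOn π S) (hπm : IntegrableOn (fun ζ => π ζ * ‖ζ‖) S)
    {F : E → G} (hF : Continuous F) (hFb : ∀ u, ‖F u‖ ≤ 1 + ‖u‖) {s : ℝ} (hs : 0 ≤ s) {z : E}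
    {b : ℝ} (hb : ∀ ζ ∈ S, Q ζ - Q z ≤ b) :
    IntegrableOn (fun ζ => (Real.exp (Q ζ - Q z) * π ζ) • F (s • (ζ - z))) S := by
  refine Integrable.mono' (g := fun ζ =>
    Real.exp b * ((1 + s * ‖z‖) * π ζ + s * (π ζ * ‖ζ‖)))
    (((hπi.const_mul _).add (hπm.const_mul _)).const_mul _)
    (aestronglyMeasurable_weight hQ hπi.1 hF s z) ?_
  filter_upwards [ae_restrict_mem₀ hS] with ζ hζ
  exact norm_weight_le hFb hs (hb ζ hζ) (hπ ζ hζ)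

theorem norm_setIntegral_weight_le {S : Set E} (hS : NullMeasurableSet S volume) {Q π : E → ℝ}
    (hπ : ∀ ζ ∈ S, 0 ≤ π ζ)
    (hπi : IntegrableOn π S) (hπm : IntegrableOn (fun ζ => π ζ * ‖ζ‖) S)
    {F : E → G} (hFb : ∀ u, ‖F u‖ ≤ 1 + ‖u‖) {s : ℝ} (hs : 0 ≤ s) {z : E}
    {b : ℝ} (hb : ∀ ζ ∈ S, Q ζ - Q z ≤ b) :
    ‖∫ ζ in S, (Real.exp (Q ζ - Q z) * π ζ) • F (s • (ζ - z))‖ ≤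
      Real.exp b * ((1 + s * ‖z‖) * ∫ ζ in S, π ζ) +
        Real.exp b * (s * ∫ ζ in S, π ζ * ‖ζ‖) := by
  have := norm_integral_le_of_norm_le (μ := volume.restrict S)
    (f := fun ζ => (Real.exp (Q ζ - Q z) * π ζ) • F (s • (ζ - z)))
    (g := fun ζ => Real.exp b * ((1 + s * ‖z‖) * π ζ + s * (π ζ * ‖ζ‖)))
    (((hπi.const_mul _).add (hπm.const_mul _)).const_mul _) (by
      filter_upwards [ae_restrict_mem₀ hS] with ζ hζ
      exact norm_weight_le hFb hs (hb ζ hζ) (hπ ζ hζ))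
  refine this.trans_eq ?_
  rw [integral_const_mul, integral_add (hπi.const_mul _) (hπm.const_mul _), integral_const_mul,
    integral_const_mul, mul_add]

theorem tendsto_sqrt_pow_mul_exp_neg (j : ℕ) {ε : ℝ} (hε : 0 < ε) :
    Tendsto (fun n : ℕ => √(n : ℝ) ^ j * Real.exp (-(n * ε))) atTop (𝓝 0) := by
  have h1 : Tendsto (fun n : ℕ => (n : ℝ) ^ j * Real.exp (-ε * n)) atTop (𝓝 0) := by
    have := (tendsto_rpow_mul_exp_neg_mul_atTop_nhds_zero j ε hε).comp
      (tendsto_natCast_atTop_atTop (R := ℝ))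
    simpa [Function.comp_def] using this
  refine squeeze_zero' (Eventually.of_forall fun n => by positivity) ?_ h1
  filter_upwards [eventually_ge_atTop 1] with n hn
  have : √(n : ℝ) ≤ n := by
    have hn' : (1 : ℝ) ≤ n := by exact_mod_cast hn
    exact Real.sqrt_le_iff.2 ⟨by linarith, by nlinarith⟩
  rw [neg_mul, mul_comm ε]
  gcongr

/-- The contribution of the complement of a ball is negligible. -/
theorem tendsto_tail_weight {S : Set E} (hS : NullMeasurableSet S volume)
    {Q : ℕ → E → ℝ} {π : E → ℝ} (hπ : ∀ ζ ∈ S, 0 ≤ π ζ)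
    (hπi : IntegrableOn π S) (hπm : IntegrableOn (fun ζ => π ζ * ‖ζ‖) S)
    {F : E → G} (hFb : ∀ u, ‖F u‖ ≤ 1 + ‖u‖) {z : ℕ → E} {ζ₀ : E}
    (hz : Tendsto z atTop (𝓝 ζ₀)) {ε : ℝ} (hε : 0 < ε)
    (hsep : ∀ᶠ n : ℕ in atTop, ∀ ζ ∈ S, Q n ζ - Q n (z n) ≤ -(n * ε)) (d : ℕ) :
    Tendsto (fun n : ℕ => √(n : ℝ) ^ d •
      ∫ ζ in S, (Real.exp (Q n ζ - Q n (z n)) * π ζ) • F (√(n : ℝ) • (ζ - z n)))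
      atTop (𝓝 0) := by
  set A := ∫ ζ in S, π ζ
  set B := ∫ ζ in S, π ζ * ‖ζ‖
  have h0 := tendsto_sqrt_pow_mul_exp_neg d hε
  -- The extra power of `√n` comes from the linear growth of `F (√n • (ζ - z n))`.
  have h1 := tendsto_sqrt_pow_mul_exp_neg (d + 1) hε
  have hlim : Tendsto (fun n : ℕ => √(n : ℝ) ^ d * Real.exp (-(n * ε)) * A +
      √(n : ℝ) ^ (d + 1) * Real.exp (-(n * ε)) * (‖z n‖ * A + B)) atTop (𝓝 0) := by
    have := (h0.mul_const A).add (h1.mul ((hz.norm.mul_const A).add_const B))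
    simpa using this
  refine squeeze_zero_norm' ?_ hlim
  filter_upwards [hsep] with n hn
  rw [norm_smul, Real.norm_of_nonneg (by positivity)]
  refine (mul_le_mul_of_nonneg_left (norm_setIntegral_weight_le hS hπ hπi hπm hFb
    (Real.sqrt_nonneg _) hn) (by positivity)).trans_eq ?_
  ring

/-- Translation invariance and the Jacobian of a dilation. The case `s = 0` is included, so the
rewriting applies to every `n`. -/
theorem integral_comp_add_inv_smul (f : E → G) (z : E) {s : ℝ} (hs : 0 ≤ s) :
    ∫ u, f (z + s⁻¹ • u) = s ^ Module.finrank ℝ E • ∫ ζ, f ζ := by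
  rw [Measure.integral_comp_inv_smul_of_nonneg volume (fun u => f (z + u)) hs,
    integral_add_left_eq_self]

/-- Laplace approximation of the contribution of a small ball. -/
theorem tendsto_ball_weight {Q : ℕ → E → ℝ} {π : E → ℝ} {ζ₀ : E} {r : ℝ} (hr : 0 < r)
    (hQm : ∀ n, AEMeasurable (Q n) (volume.restrict (Metric.ball ζ₀ r)))
    (hπm : AEStronglyMeasurable π (volume.restrict (Metric.ball ζ₀ r)))
    {C : ℝ} (hπC : ∀ ζ ∈ Metric.ball ζ₀ r, |π ζ| ≤ C) (hπc : ContinuousAt π ζ₀)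
    {F : E → G} (hF : Continuous F) (hFb : ∀ u, ‖F u‖ ≤ 1 + ‖u‖)
    {z : ℕ → E} (hz : Tendsto z atTop (𝓝 ζ₀))
    {q : E → ℝ} (hqs : ∀ (s : ℝ) u, q (s • u) = s ^ 2 * q u)
    {c : ℝ} (hc : 0 < c) (hqc : ∀ u, c * ‖u‖ ^ 2 ≤ q u)
    (hexp : ∀ η > 0, ∃ r > 0, ∀ᶠ n : ℕ in atTop, ∀ ζ ∈ Metric.ball ζ₀ r,
      |Q n ζ - Q n (z n) + n / 2 * q (ζ - z n)| ≤ n * η * ‖ζ - z n‖ ^ 2)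
    (hexpr : ∀ᶠ n : ℕ in atTop, ∀ ζ ∈ Metric.ball ζ₀ r,
      |Q n ζ - Q n (z n) + n / 2 * q (ζ - z n)| ≤ n * (c / 4) * ‖ζ - z n‖ ^ 2) :
    Tendsto (fun n : ℕ => √(n : ℝ) ^ Module.finrank ℝ E • ∫ ζ in Metric.ball ζ₀ r,
      (Real.exp (Q n ζ - Q n (z n)) * π ζ) • F (√(n : ℝ) • (ζ - z n)))
      atTop (𝓝 (∫ u, (Real.exp (-(q u / 2)) * π ζ₀) • F u)) := by
  have hC0 : 0 ≤ C := (abs_nonneg _).trans (hπC ζ₀ (Metric.mem_ball_self hr))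
  -- The indicator keeps the domain of integration fixed when the variable is rescaled.
  set f : ℕ → E → G := fun n => (Metric.ball ζ₀ r).indicator fun ζ =>
    (Real.exp (Q n ζ - Q n (z n)) * π ζ) • F (√(n : ℝ) • (ζ - z n)) with hf
  have hfm : ∀ n, AEStronglyMeasurable (f n) volume := fun n =>
    (aestronglyMeasurable_indicator_iff measurableSet_ball).2
      (aestronglyMeasurable_weight (hQm n) hπm hF _ _)
  have hrw : ∀ n : ℕ, √(n : ℝ) ^ Module.finrank ℝ E • ∫ ζ in Metric.ball ζ₀ r,
      (Real.exp (Q n ζ - Q n (z n)) * π ζ) • F (√(n : ℝ) • (ζ - z n)) =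
      ∫ u, f n (z n + (√(n : ℝ))⁻¹ • u) := fun n => by
    rw [integral_comp_add_inv_smul _ _ (Real.sqrt_nonneg _), integral_indicator measurableSet_ball]
  simp_rw [hrw]
  have hsc : ∀ (n : ℕ), 0 < n → ∀ (w : ℝ) (u : E),
      n * w * ‖(√(n : ℝ))⁻¹ • u‖ ^ 2 = w * ‖u‖ ^ 2 := fun n hn w u => by
    have hn' : (0 : ℝ) < n := Nat.cast_pos.2 hn
    rw [norm_smul, mul_pow, norm_inv, inv_pow, Real.norm_of_nonneg (Real.sqrt_nonneg _),
      Real.sq_sqrt hn'.le]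
    field_simp
  have hscq : ∀ (n : ℕ), 0 < n → ∀ u : E, n / 2 * q ((√(n : ℝ))⁻¹ • u) = q u / 2 := fun n hn u => by
    have hn' : (0 : ℝ) < n := Nat.cast_pos.2 hn
    rw [hqs, inv_pow, Real.sq_sqrt hn'.le]
    field_simp
  have hpt : ∀ u : E, Tendsto (fun n : ℕ => z n + (√(n : ℝ))⁻¹ • u) atTop (𝓝 ζ₀) := fun u => by
    have h1 : Tendsto (fun n : ℕ => (√(n : ℝ))⁻¹) atTop (𝓝 0) :=
      tendsto_inv_atTop_zero.comp (Real.tendsto_sqrt_atTop.comp tendsto_natCast_atTop_atTop)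
    simpa using hz.add (h1.smul_const u)
  refine tendsto_integral_filter_of_dominated_convergence
    (fun u => C * (Real.exp (-(c / 4 * ‖u‖ ^ 2)) * (1 + ‖u‖))) ?_ ?_
    ((integrable_exp_neg_mul_sq_norm_mul_one_add_norm (by positivity)).const_mul C) ?_
  · filter_upwards [eventually_gt_atTop 0] with n hn
    have hn' : (0 : ℝ) < n := Nat.cast_pos.2 hn
    exact aestronglyMeasurable_comp_add_smul (hfm n) _ (by positivity)
  · filter_upwards [hexpr, eventually_gt_atTop 0] with n hn hn0
    refine ae_of_all _ fun u => ?_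
    have hn' : (0 : ℝ) < n := Nat.cast_pos.2 hn0
    by_cases hu : z n + (√(n : ℝ))⁻¹ • u ∈ Metric.ball ζ₀ r
    · have h1 := hn _ hu
      rw [add_sub_cancel_left, hsc n hn0, hscq n hn0] at h1
      simp only [hf, Set.indicator_of_mem hu, add_sub_cancel_left]
      rw [smul_inv_smul₀ (by positivity), norm_smul, norm_mul, Real.norm_of_nonneg (by positivity)]
      have h2 := hπC _ hu
      have h3 := hFb u
      have h4 : Real.exp (Q n (z n + (√(n : ℝ))⁻¹ • u) - Q n (z n)) ≤
          Real.exp (-(c / 4 * ‖u‖ ^ 2)) := by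
        -- The main term is at most `-(c / 2) * ‖u‖ ^ 2` and the error at most `c / 4 * ‖u‖ ^ 2`,
        -- which leaves `-(c / 4) * ‖u‖ ^ 2`.
        refine Real.exp_le_exp.2 ?_
        have := hqc u
        have := (abs_le.1 h1).2
        linarith
      calc _ ≤ Real.exp (-(c / 4 * ‖u‖ ^ 2)) * C * (1 + ‖u‖) := by
            gcongr
            exact h2
        _ = _ := by ring
    · simp only [hf, Set.indicator_of_notMem hu, norm_zero]
      positivity
  · refine ae_of_all _ fun u => ?_
    have hQlim : Tendsto (fun n : ℕ => Q n (z n + (√(n : ℝ))⁻¹ • u) - Q n (z n)) atTop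
        (𝓝 (-(q u / 2))) := by
      rw [Metric.tendsto_nhds]
      intro e he
      -- For fixed `u` the rescaled error is `η * ‖u‖ ^ 2`; this `η` makes it less than `e`.
      obtain ⟨ρ, hρ, hev⟩ := hexp (e / (‖u‖ ^ 2 + 1)) (by positivity)
      filter_upwards [hev, eventually_gt_atTop 0,
        (hpt u).eventually (Metric.ball_mem_nhds _ hρ)] with n hn hn0 hmem
      have h1 := hn _ hmem
      rw [add_sub_cancel_left, hsc n hn0, hscq n hn0] at h1
      rw [Real.dist_eq, sub_neg_eq_add]
      refine h1.trans_lt ?_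
      rw [div_mul_eq_mul_div, div_lt_iff₀ (by positivity)]
      nlinarith
    have hlim := ((Real.continuous_exp.tendsto _).comp hQlim).mul (hπc.tendsto.comp (hpt u))
    refine (hlim.smul_const (F u)).congr' ?_
    filter_upwards [(hpt u).eventually (Metric.ball_mem_nhds _ hr), eventually_gt_atTop 0]
      with n hmem hn0
    have hn' : (0 : ℝ) < n := Nat.cast_pos.2 hn0
    have hmem' : z n + (√(n : ℝ))⁻¹ • u ∈ Metric.ball ζ₀ r := hmem
    simp only [hf, Set.indicator_of_mem hmem', add_sub_cancel_left]
    rw [smul_inv_smul₀ (by positivity)]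
    rfl

/-- **Laplace approximation** for an integral over `Z` against a weight `exp (Q n) * π`, when
`Q n` has a quadratic expansion at its maximizer and is well separated from its maximum away
from the limit of the maximizers. -/
theorem tendsto_laplace {Z : Set E} (hZm : NullMeasurableSet Z volume) {Q : ℕ → E → ℝ} {π : E → ℝ}
    {ζ₀ : E} (hZ : Z ∈ 𝓝 ζ₀) (hQm : ∀ n, AEMeasurable (Q n) (volume.restrict Z))
    (hπ : ∀ ζ ∈ Z, 0 ≤ π ζ) (hπi : IntegrableOn π Z)
    (hπm : IntegrableOn (fun ζ => π ζ * ‖ζ‖) Z) (hπc : ContinuousAt π ζ₀)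
    {F : E → G} (hF : Continuous F) (hFb : ∀ u, ‖F u‖ ≤ 1 + ‖u‖)
    {z : ℕ → E} (hz : Tendsto z atTop (𝓝 ζ₀))
    (hmax : ∀ᶠ n in atTop, IsMaxOn (Q n) Z (z n))
    {q : E → ℝ} (hqs : ∀ (s : ℝ) u, q (s • u) = s ^ 2 * q u)
    {c : ℝ} (hc : 0 < c) (hqc : ∀ u, c * ‖u‖ ^ 2 ≤ q u)
    (hexp : ∀ η > 0, ∃ r > 0, ∀ᶠ n : ℕ in atTop, ∀ ζ ∈ Metric.ball ζ₀ r,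
      |Q n ζ - Q n (z n) + n / 2 * q (ζ - z n)| ≤ n * η * ‖ζ - z n‖ ^ 2)
    (hsep : ∀ δ > 0, ∃ ε > 0, ∀ᶠ n : ℕ in atTop, ∀ ζ ∈ Z \ Metric.ball ζ₀ δ,
      Q n ζ - Q n (z n) ≤ -(n * ε)) :
    Tendsto (fun n : ℕ => √(n : ℝ) ^ Module.finrank ℝ E • ∫ ζ in Z,
      (Real.exp (Q n ζ - Q n (z n)) * π ζ) • F (√(n : ℝ) • (ζ - z n)))
      atTop (𝓝 (∫ u, (Real.exp (-(q u / 2)) * π ζ₀) • F u)) := by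
  -- The radius is chosen once: the error is small enough for a Gaussian majorant, `π` is bounded,
  -- and the ball lies in `Z`.
  obtain ⟨r₁, hr₁, hexp₁⟩ := hexp (c / 4) (by positivity)
  obtain ⟨r₂, hr₂, hπ₂⟩ := Metric.eventually_nhds_iff_ball.1
    (hπc.abs.eventually (eventually_le_nhds (lt_add_one |π ζ₀|)))
  obtain ⟨r₃, hr₃, hZ₃⟩ := Metric.mem_nhds_iff.1 hZ
  set r := min r₁ (min r₂ r₃)
  have hr : 0 < r := lt_min hr₁ (lt_min hr₂ hr₃)
  have hr₁' : Metric.ball ζ₀ r ⊆ Metric.ball ζ₀ r₁ := Metric.ball_subset_ball (min_le_left _ _)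
  have hr₂' : Metric.ball ζ₀ r ⊆ Metric.ball ζ₀ r₂ :=
    Metric.ball_subset_ball ((min_le_right _ _).trans (min_le_left _ _))
  have hrZ : Metric.ball ζ₀ r ⊆ Z :=
    (Metric.ball_subset_ball ((min_le_right _ _).trans (min_le_right _ _))).trans hZ₃
  obtain ⟨ε, hε, hsepε⟩ := hsep r hr
  have hnear := tendsto_ball_weight hr (fun n => (hQm n).mono_measure (Measure.restrict_mono hrZ le_rfl))
    (hπi.mono_set hrZ).1 (fun ζ hζ => hπ₂ ζ (hr₂' hζ)) hπc hF hFb hz hqs hc hqc hexp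
    (hexp₁.mono fun n hn ζ hζ => hn ζ (hr₁' hζ))
  have hfar := tendsto_tail_weight (hZm.diff measurableSet_ball.nullMeasurableSet)
    (fun ζ hζ => hπ ζ hζ.1) (hπi.mono_set Set.sdiff_subset) (hπm.mono_set Set.sdiff_subset) hFb hz hε
    hsepε (Module.finrank ℝ E)
  have := hnear.add hfar
  rw [add_zero] at this
  refine this.congr' ?_
  filter_upwards [hmax] with n hn
  have hint := integrableOn_weight hZm (hQm n) hπ hπi hπm hF hFb (Real.sqrt_nonneg n) (z := z n)
    (b := 0) fun ζ hζ => sub_nonpos.2 (hn hζ)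
  rw [← smul_add, ← setIntegral_union₀]
  · rw [Set.union_sdiff_cancel hrZ]
  · exact Set.disjoint_sdiff_right.aedisjoint
  · exact hZm.diff measurableSet_ball.nullMeasurableSet
  · exact hint.mono_set hrZ
  · exact hint.mono_set Set.sdiff_subset

end Laplace

/-! ### From the Laplace approximation to the posterior mean -/

section PosteriorMean

variable {E : Type*} [NormedAddCommGroup E] [InnerProductSpace ℝ E] [FiniteDimensional ℝ E]
  [MeasurableSpace E] [BorelSpace E]

theorem integral_exp_neg_half_mul_pos {q : E → ℝ} (hq : Continuous q) {c : ℝ} (hc : 0 < c)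
    (hqc : ∀ u, c * ‖u‖ ^ 2 ≤ q u) {a : ℝ} (ha : 0 < a) :
    0 < ∫ u, Real.exp (-(q u / 2)) * a := by
  rw [integral_mul_const]
  refine mul_pos (integral_exp_pos ?_) ha
  refine (integrable_exp_neg_mul_sq_norm_mul_one_add_norm (a := c / 2) (by positivity)).mono'
    (Continuous.aestronglyMeasurable (by fun_prop)) (ae_of_all _ fun u => ?_)
  rw [Real.norm_of_nonneg (Real.exp_pos _).le]
  have h1 : Real.exp (-(q u / 2)) ≤ Real.exp (-(c / 2 * ‖u‖ ^ 2)) :=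
    Real.exp_le_exp.2 (by linarith [hqc u])
  exact h1.trans (le_mul_of_one_le_right (Real.exp_pos _).le (by linarith [norm_nonneg u]))

/-- Homogeneity of degree two makes `q` even, so the integrand is odd and the integral equals its
own negative. -/
theorem integral_exp_neg_half_mul_smul_self {q : E → ℝ}
    (hqs : ∀ (s : ℝ) u, q (s • u) = s ^ 2 * q u) (a : ℝ) :
    ∫ u, (Real.exp (-(q u / 2)) * a) • u = 0 := by
  have h : ∀ u, q (-u) = q u := fun u => by simpa using hqs (-1) u
  have := integral_neg_eq_self (fun u => (Real.exp (-(q u / 2)) * a) • u) (volume : Measure E)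
  simp only [h, smul_neg, integral_neg] at this
  rw [eq_comm, eq_neg_iff_add_eq_zero, ← two_smul ℝ] at this
  exact (smul_eq_zero.1 this).resolve_left two_ne_zero

/-- A probability density proportional to `exp (Q n) * π` is eventually well defined, has a finite
expectation, and its expectation is within `o(n^{-1/2})` of the maximizer of `Q n`, when `Q n` has
a quadratic expansion at its maximizer and is well separated from its maximum elsewhere. -/
theorem posterior_mean_sub_argmax {Z : Set E} (hZm : NullMeasurableSet Z volume)
    {Q : ℕ → E → ℝ} {π : E → ℝ}
    {ζ₀ : E} (hZ : Z ∈ 𝓝 ζ₀) (hQm : ∀ n, AEMeasurable (Q n) (volume.restrict Z))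
    (hπ : ∀ ζ ∈ Z, 0 ≤ π ζ) (hπi : IntegrableOn π Z)
    (hπm : IntegrableOn (fun ζ => π ζ * ‖ζ‖) Z) (hπc : ContinuousAt π ζ₀) (hπ₀ : 0 < π ζ₀)
    {z : ℕ → E} (hz : Tendsto z atTop (𝓝 ζ₀))
    (hmax : ∀ᶠ n in atTop, IsMaxOn (Q n) Z (z n))
    {q : E → ℝ} (hq : Continuous q) (hqs : ∀ (s : ℝ) u, q (s • u) = s ^ 2 * q u)
    {c : ℝ} (hc : 0 < c) (hqc : ∀ u, c * ‖u‖ ^ 2 ≤ q u)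
    (hexp : ∀ η > 0, ∃ r > 0, ∀ᶠ n : ℕ in atTop, ∀ ζ ∈ Metric.ball ζ₀ r,
      |Q n ζ - Q n (z n) + n / 2 * q (ζ - z n)| ≤ n * η * ‖ζ - z n‖ ^ 2)
    (hsep : ∀ δ > 0, ∃ ε > 0, ∀ᶠ n : ℕ in atTop, ∀ ζ ∈ Z \ Metric.ball ζ₀ δ,
      Q n ζ - Q n (z n) ≤ -(n * ε))
    {κ : ℕ → E → ℝ}
    (hκ : ∀ n ζ, κ n ζ = Real.exp (Q n ζ) * π ζ / ∫ x in Z, Real.exp (Q n x) * π x) :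
    (∀ᶠ n in atTop, IntegrableOn (κ n) Z ∧ ∫ ζ in Z, κ n ζ = 1 ∧
      IntegrableOn (fun ζ => κ n ζ • ζ) Z) ∧
    Tendsto (fun n : ℕ => √(n : ℝ) • ((∫ ζ in Z, κ n ζ • ζ) - z n)) atTop (𝓝 0) := by
  have hF1 : ∀ u : E, ‖(fun _ : E => (1 : ℝ)) u‖ ≤ 1 + ‖u‖ := fun u => by simp
  have hFid : ∀ u : E, ‖(fun u : E => u) u‖ ≤ 1 + ‖u‖ := fun u => by simp
  -- Dividing by the maximum `exp (Q n (z n))` does not change the normalized density.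
  set w : ℕ → E → ℝ := fun n ζ => Real.exp (Q n ζ - Q n (z n)) * π ζ with hw
  set D : ℕ → ℝ := fun n => ∫ ζ in Z, w n ζ
  have hden := tendsto_laplace hZm hZ hQm hπ hπi hπm hπc continuous_const hF1 hz hmax hqs hc hqc
    hexp hsep
  have hnum := tendsto_laplace hZm hZ hQm hπ hπi hπm hπc continuous_id' hFid hz hmax hqs hc hqc
    hexp hsep
  have hL := integral_exp_neg_half_mul_pos hq hc hqc hπ₀
  simp only [smul_eq_mul, mul_one] at hden
  rw [integral_exp_neg_half_mul_smul_self hqs] at hnum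
  have hκw : ∀ n, κ n = fun ζ => (D n)⁻¹ * w n ζ := by
    intro n
    funext ζ
    have h : ∀ x, Real.exp (Q n x) * π x = Real.exp (Q n (z n)) * w n x := fun x => by
      rw [hw, ← mul_assoc, ← Real.exp_add, add_sub_cancel]
    simp only [hκ, h, integral_const_mul]
    rw [mul_div_mul_left _ _ (Real.exp_ne_zero _), div_eq_inv_mul]
  have hev : ∀ᶠ n in atTop, 0 < D n ∧ IntegrableOn (w n) Z ∧
      IntegrableOn (fun ζ => w n ζ • (ζ - z n)) Z := by
    filter_upwards [hmax, hden.eventually (lt_mem_nhds hL)] with n hn hpos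
    have hb : ∀ ζ ∈ Z, Q n ζ - Q n (z n) ≤ 0 := fun ζ hζ => sub_nonpos.2 (hn hζ)
    have h1 := integrableOn_weight hZm (hQm n) hπ hπi hπm continuous_const hF1 zero_le_one hb
    -- Scale `s = 1` gives integrability of `w n ζ • (ζ - z n)`, hence of `w n ζ • ζ`.
    have h2 := integrableOn_weight hZm (hQm n) hπ hπi hπm continuous_id' hFid zero_le_one hb
    exact ⟨pos_of_mul_pos_right hpos (by positivity), by simpa using h1, by simpa using h2⟩
  have hsmul : ∀ n ζ, w n ζ • ζ = w n ζ • (ζ - z n) + w n ζ • z n := fun n ζ => by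
    rw [← smul_add, sub_add_cancel]
  constructor
  · filter_upwards [hev] with n ⟨hDpos, hw1, hw2⟩
    simp only [hκw]
    refine ⟨hw1.const_mul _, ?_, ?_⟩
    · rw [integral_const_mul]
      exact inv_mul_cancel₀ hDpos.ne'
    · simp only [mul_smul, hsmul]
      exact (hw2.add (hw1.smul_const (z n))).smul ((D n)⁻¹)
  -- The Jacobian factors of numerator and denominator cancel; the `√n` inside `F` is the one in the
  -- claim.
  · have hlim := (hden.inv₀ hL.ne').smul hnum
    rw [smul_zero] at hlim
    refine hlim.congr' ?_
    filter_upwards [hev, eventually_gt_atTop 0] with n ⟨hDpos, hw1, hw2⟩ hn0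
    have hn' : (0 : ℝ) < n := Nat.cast_pos.2 hn0
    have hs0 : √(n : ℝ) ^ Module.finrank ℝ E ≠ 0 := by positivity
    have hmean : (∫ ζ in Z, κ n ζ • ζ) - z n = (D n)⁻¹ • ∫ ζ in Z, w n ζ • (ζ - z n) := by
      simp only [hκw, mul_smul, hsmul]
      rw [integral_smul, integral_add hw2 (hw1.smul_const (z n)), integral_smul_const, smul_add,
        inv_smul_smul₀ hDpos.ne', add_sub_cancel_right]
    have hsc : ∫ ζ in Z, w n ζ • (√(n : ℝ) • (ζ - z n)) =
        √(n : ℝ) • ∫ ζ in Z, w n ζ • (ζ - z n) := by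
      simp only [smul_comm _ (√(n : ℝ)), integral_smul]
    rw [hmean]
    change (_ * D n)⁻¹ • _ • ∫ ζ in Z, w n ζ • (√(n : ℝ) • (ζ - z n)) = _
    rw [hsc, smul_smul, mul_inv, mul_right_comm, inv_mul_cancel₀ hs0, one_mul, smul_comm]

end PosteriorMean

/-! ### Coercivity of the information and almost sure inputs -/

/-- The quadratic form of a positive definite matrix is bounded below by a multiple of the
squared norm. -/
theorem Matrix.PosDef.exists_mul_sq_norm_le {k : ℕ} {A : Matrix (Fin k) (Fin k) ℝ}
    (hA : A.PosDef) : ∃ c > 0, ∀ v : EuclideanSpace ℝ (Fin k),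
      c * ‖v‖ ^ 2 ≤ ∑ j, ∑ i, v j * v i * A i j := by
  set q : EuclideanSpace ℝ (Fin k) → ℝ := fun v => ∑ j, ∑ i, v j * v i * A i j with hq
  have hqc : Continuous q := by fun_prop
  have hqs : ∀ (s : ℝ) v, q (s • v) = s ^ 2 * q v := fun s v => by
    simp only [hq, PiLp.smul_apply, smul_eq_mul, Finset.mul_sum]
    exact Finset.sum_congr rfl fun j _ => Finset.sum_congr rfl fun i _ => by ring
  have hpos : ∀ v, v ≠ 0 → 0 < q v := fun v hv => by
    have hv' : (fun i => v i) ≠ 0 := fun h => hv (by ext i; exact congrFun h i)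
    have := hA.dotProduct_mulVec_pos hv'
    simp only [dotProduct, Matrix.mulVec, Finset.mul_sum] at this
    rw [Finset.sum_comm] at this
    refine this.trans_eq (Finset.sum_congr rfl fun j _ => Finset.sum_congr rfl fun i _ => ?_)
    simp
    ring
  rcases (Metric.sphere (0 : EuclideanSpace ℝ (Fin k)) 1).eq_empty_or_nonempty with he | hne
  -- An empty unit sphere means a trivial space, the case `k = 0`.
  · refine ⟨1, one_pos, fun v => ?_⟩
    have hv : v = 0 := by
      by_contra hv
      have : (‖v‖⁻¹ • v) ∈ Metric.sphere (0 : EuclideanSpace ℝ (Fin k)) 1 := by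
        simp [norm_smul, hv]
      simp [he] at this
    simp [hv]
  -- The constant is the minimum of `q` on the compact unit sphere; homogeneity extends the bound to
  -- all `v`.
  · obtain ⟨x, hx, hmin⟩ := (isCompact_sphere (0 : EuclideanSpace ℝ (Fin k)) 1).exists_isMinOn hne
      hqc.continuousOn
    have hx0 : x ≠ 0 := fun h => by simp [h] at hx
    refine ⟨q x, hpos x hx0, fun v => ?_⟩
    by_cases hv : v = 0
    · simp [hv]
    · have hmem : (‖v‖⁻¹ • v) ∈ Metric.sphere (0 : EuclideanSpace ℝ (Fin k)) 1 := by
        simp [norm_smul, hv]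
      have h1 : q x ≤ q (‖v‖⁻¹ • v) := hmin hmem
      have hv' : 0 < ‖v‖ := norm_pos_iff.2 hv
      rw [hqs, inv_pow, inv_mul_eq_div, le_div_iff₀ (by positivity)] at h1
      exact h1

/-- The strong law of large numbers for a function of i.i.d. observations. -/
theorem strong_law_ae_comp {Ω S : Type*} [MeasurableSpace Ω] [MeasurableSpace S] {μ : Measure Ω}
    {P : Measure S} {Y : ℕ → Ω → S} (hYm : ∀ i, Measurable (Y i)) (hYind : iIndepFun Y μ)
    (hYlaw : ∀ i, μ.map (Y i) = P) {g : S → ℝ} (hg : Integrable g P) :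
    ∀ᵐ ω ∂μ, Tendsto (fun n : ℕ => (∑ i ∈ Finset.range n, g (Y i ω)) / n) atTop
      (𝓝 (∫ y, g y ∂P)) := by
  have hgm : ∀ i, AEMeasurable g (μ.map (Y i)) := fun i => by
    rw [hYlaw]; exact hg.1.aemeasurable
  have h := strong_law_ae_real (μ := μ) (fun i ω => g (Y i ω))
    ((integrable_map_measure (by rw [hYlaw]; exact hg.1) (hYm 0).aemeasurable).1
      (by rw [hYlaw]; exact hg))
    (fun i j hij => (hYind.indepFun hij).comp₀ (hYm i).aemeasurable (hYm j).aemeasurable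
      (hgm i) (hgm j))
    (fun i => (IdentDistrib.mk (hYm i).aemeasurable (hYm 0).aemeasurable
      (by rw [hYlaw, hYlaw])).comp_of_aemeasurable (hgm i))
  have hint : ∫ ω, g (Y 0 ω) ∂μ = ∫ y, g y ∂P := by
    rw [← hYlaw 0, integral_map (hYm 0).aemeasurable (by rw [hYlaw]; exact hg.1)]
  rwa [hint] at h

/-- The exceptional null set may depend on `δ`. Restricting to radii `1 / (m + 1)` leaves countably
many null sets, and a smaller ball gives a stronger bound. -/
theorem WellSeparated.ae_forall {p k : ℕ} {Ω : Type*} [MeasurableSpace Ω] {μ : Measure Ω}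
    {Y : ℕ → Ω → EuclideanSpace ℝ (Fin p)}
    {f₁ : EuclideanSpace ℝ (Fin p) → EuclideanSpace ℝ (Fin k) → ℝ}
    {Z : Set (EuclideanSpace ℝ (Fin k))} {ζ₀ : EuclideanSpace ℝ (Fin k)}
    (h : WellSeparated μ Y f₁ Z ζ₀) :
    ∀ᵐ ω ∂μ, ∀ δ > 0, ∃ ε > 0, ∀ᶠ n : ℕ in atTop, ∀ ζ ∈ Z \ Metric.ball ζ₀ δ,
      compLogLik f₁ (fun i => Y i ω) n ζ - compLogLik f₁ (fun i => Y i ω) n ζ₀ ≤ -(n * ε) := by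
  choose! ε hε hev using h
  have hall := ae_all_iff.2 fun m : ℕ => hev (1 / ((m : ℝ) + 1)) (by positivity)
  filter_upwards [hall] with ω hω δ hδ
  obtain ⟨m, hm⟩ := exists_nat_one_div_lt hδ
  refine ⟨_, hε (1 / ((m : ℝ) + 1)) (by positivity), ?_⟩
  filter_upwards [hω m, eventually_gt_atTop 0] with n hn hn0 ζ hζ
  have hn' : (0 : ℝ) < n := Nat.cast_pos.2 hn0
  have h1 := hn ζ ⟨hζ.1, fun h => hζ.2 (Metric.ball_subset_ball hm.le h)⟩
  rw [one_div, inv_mul_eq_div, div_lt_iff₀ hn'] at h1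
  linarith

/-- Almost surely, the averaged Hessians of the composite log-likelihood converge to minus the
Fisher information, locally uniformly at the true parameter. -/
theorem ae_tendsto_average_hessian {p k : ℕ} {Ω : Type*} [MeasurableSpace Ω] {μ : Measure Ω}
    {P : Measure (EuclideanSpace ℝ (Fin p))} {Y : ℕ → Ω → EuclideanSpace ℝ (Fin p)}
    (hYm : ∀ i, Measurable (Y i)) (hYind : iIndepFun Y μ) (hYlaw : ∀ i, μ.map (Y i) = P)
    {f₁ : EuclideanSpace ℝ (Fin p) → EuclideanSpace ℝ (Fin k) → ℝ}
    {ζ₀ : EuclideanSpace ℝ (Fin k)} {δ : ℝ} (hδ : 0 < δ)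
    (hsm : ∀ᵐ y ∂P, ThriceDifferentiableOn (logLik f₁ y) (Metric.ball ζ₀ δ))
    {i j : Fin k} (hint : Integrable (fun y => partialD i (partialD j (logLik f₁ y)) ζ₀) P)
    {M : Fin k → EuclideanSpace ℝ (Fin p) → ℝ} (hM : ∀ l, Integrable (M l) P)
    (hMb : ∀ l, ∀ᵐ y ∂P, ∀ ζ ∈ Metric.ball ζ₀ δ,
      |partialD l (partialD i (partialD j (logLik f₁ y))) ζ| ≤ M l y) :
    ∀ᵐ ω ∂μ, Tendsto (fun q : ℕ × EuclideanSpace ℝ (Fin k) =>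
      (∑ m ∈ Finset.range q.1, partialD i (partialD j (logLik f₁ (Y m ω))) q.2) / q.1)
      (atTop ×ˢ 𝓝 ζ₀) (𝓝 (-fisherInfo P f₁ ζ₀ i j)) := by
  have hpull : ∀ {s : EuclideanSpace ℝ (Fin p) → Prop}, (∀ᵐ y ∂P, s y) →
      ∀ᵐ ω ∂μ, ∀ m, s (Y m ω) := fun hs =>
    ae_all_iff.2 fun m => ae_of_ae_map (hYm m).aemeasurable (by rwa [hYlaw m])
  filter_upwards [hpull hsm, hpull (ae_all_iff.2 hMb),
    strong_law_ae_comp hYm hYind hYlaw hint,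
    ae_all_iff.2 fun l => strong_law_ae_comp hYm hYind hYlaw (hM l)] with ω h1 h2 h3 h4
  have hI : -fisherInfo P f₁ ζ₀ i j = ∫ y, partialD i (partialD j (logLik f₁ y)) ζ₀ ∂P := by
    simp [fisherInfo]
  rw [hI]
  exact tendsto_average_prod_nhds (M := fun l m => M l (Y m ω)) hδ (fun m => (h1 m).2.2 i j) h2
    h3 h4

/-! ### Assembly for almost every data sequence -/

theorem lemma4 {p d k : ℕ} (M : DominatedModel p d)
    (θ₀ : EuclideanSpace ℝ (Fin d)) (hθ₀ : θ₀ ∈ interior M.paramSet)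
    -- `ζ` is a sub-vector of `θ`, with true value `ζ₀` and parameter set `Z`
    (sel : Fin k ↪ Fin d)
    (ζ₀ : EuclideanSpace ℝ (Fin k)) (hζ₀ : ζ₀ = subvector sel θ₀)
    (Z : Set (EuclideanSpace ℝ (Fin k))) (hZ : Z = subvector sel '' M.paramSet)
    (hZm : NullMeasurableSet Z volume)
    -- i.i.d. observations from `P_θ₀`
    {Ω : Type*} [MeasurableSpace Ω] (μ : Measure Ω) [IsProbabilityMeasure μ]
    (Y : ℕ → Ω → EuclideanSpace ℝ (Fin p)) (hYm : ∀ i, Measurable (Y i))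
    (hYind : iIndepFun Y μ) (hYlaw : ∀ i, μ.map (Y i) = M.law θ₀)
    -- the pseudo-density, the maximizer of the composite likelihood, and the conditions on them
    (f₁ : EuclideanSpace ℝ (Fin p) → EuclideanSpace ℝ (Fin k) → ℝ)
    (ζt : ℕ → Ω → EuclideanSpace ℝ (Fin k))
    (hf₁ : IsPseudoDensity f₁ Z)
    (hsupp : CommonSupport f₁ Z)
    (hsmooth : SmoothLogLik (M.law θ₀) f₁ Z ζ₀)
    (hfisher : FisherRegular (M.law θ₀) f₁ ζ₀)
    (hsep : WellSeparated μ Y f₁ Z ζ₀)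
    (hmax : ConsistentMaximizer μ Y f₁ Z ζ₀ ζt)
    -- the prior, of finite expectation
    (π₀ : EuclideanSpace ℝ (Fin k) → ℝ) (hπ : IsPriorDensity π₀ Z ζ₀)
    (hπmean : IntegrableOn (fun ζ => π₀ ζ • ζ) Z) :
    ∀ᵐ ω ∂μ,
      -- eventually the posterior is a probability density with a finite expectation
      (∀ᶠ n in atTop,
        IntegrableOn (knotPosterior f₁ Z π₀ (fun i => Y i ω) n) Z ∧
        ∫ ζ in Z, knotPosterior f₁ Z π₀ (fun i => Y i ω) n ζ = 1 ∧
        IntegrableOn (fun ζ => knotPosterior f₁ Z π₀ (fun i => Y i ω) n ζ • ζ) Z) ∧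
      Tendsto (fun n : ℕ =>
        √(n : ℝ) • (knotPosteriorMean f₁ Z π₀ (fun i => Y i ω) n - ζt n ω)) atTop (𝓝 0) := by

  obtain ⟨δ, hδ, hball, hsm, hint, B, hB, hBb⟩ := hsmooth
  have hZnhds : Z ∈ 𝓝 ζ₀ := mem_of_superset (Metric.ball_mem_nhds ζ₀ hδ) hball
  obtain ⟨c, hc, hqc⟩ := hfisher.posDef.exists_mul_sq_norm_le
  have hsm' : ∀ᵐ ω ∂μ, ∀ m,
      ThriceDifferentiableOn (logLik f₁ (Y m ω)) (Metric.ball ζ₀ δ) :=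
    ae_all_iff.2 fun m => ae_of_ae_map (hYm m).aemeasurable (by
      rw [hYlaw m]
      exact hsm.mono fun y hy => hy.2)
  have hhess := ae_all_iff.2 fun i => ae_all_iff.2 fun j =>
    ae_tendsto_average_hessian hYm hYind hYlaw hδ (hsm.mono fun y hy => hy.2)
      ((hint ζ₀ (Metric.mem_ball_self hδ)).2 i j) (fun l => hB l i j) (fun l => hBb l i j)
  have hπm : IntegrableOn (fun ζ => π₀ ζ * ‖ζ‖) Z := by
    refine hπmean.norm.congr ?_
    filter_upwards [ae_restrict_mem₀ hZm] with ζ hζ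
    rw [norm_smul, Real.norm_of_nonneg (hπ.nonneg ζ hζ)]
  filter_upwards [hsm', hhess, hsep.ae_forall, hmax.isMax, hmax.consistent]
    with ω hdiff hH hfar hmx hz
  -- By consistency, `Z` is eventually a neighbourhood of the maximizer, so the maximum over `Z` is
  -- a local one.
  have hloc : ∀ᶠ n in atTop, IsLocalMax (compLogLik f₁ (fun i => Y i ω) n) (ζt n ω) := by
    filter_upwards [hmx, hz.eventually (eventually_mem_nhds_iff.2 hZnhds)] with n hn hnz
    exact hn.2.isLocalMax hnz
  refine posterior_mean_sub_argmax hZm (Q := compLogLik f₁ fun i => Y i ω)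
    (q := fun v => ∑ j, ∑ i, v j * v i * fisherInfo (M.law θ₀) f₁ ζ₀ i j) hZnhds
    (fun n => ?_) hπ.nonneg hπ.integrableOn hπm hπ.continuousAt hπ.pos hz
    (hmx.mono fun n hn => hn.2) (by fun_prop) (fun s v => ?_) hc hqc
    (fun η hη => quadratic_expansion_near_argmax hδ hdiff hH hz hloc hη) (fun r hr => ?_)
    (fun n ζ => rfl)
  · exact Finset.aemeasurable_fun_sum _ fun m _ =>
      Real.measurable_log.comp_aemeasurable (hf₁.measurable_param _)
  · simp only [PiLp.smul_apply, smul_eq_mul, Finset.mul_sum]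
    exact Finset.sum_congr rfl fun j _ => Finset.sum_congr rfl fun i _ => by ring
  · obtain ⟨ε, hε, hev⟩ := hfar r hr
    refine ⟨ε, hε, ?_⟩
    filter_upwards [hev, hmx] with n hn hnmax ζ hζ
    have := hn ζ hζ
    -- Separation is assumed relative to `ζ₀`; passing to the maximizer only lowers the difference.
    have : compLogLik f₁ (fun i => Y i ω) n ζ₀ ≤ compLogLik f₁ (fun i => Y i ω) n (ζt n ω) :=
      hnmax.2 (mem_of_mem_nhds hZnhds)
    linarith
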